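/- Let $k\ge 1$ be a fixed integer, $M_d=M_d(\mathbb C)$, and let $D_d\subset M_d$ be the set of states (positive semidefinite matrices of trace one). For each $n\in\mathbb N$ let $P_n\in M_k\otimes M_n\cong M_{kn}$ be a self-adjoint projection. For an integer $m\ge 1$, the sequence $(P_n)$ satisfies condition $\mathcal C_m$ if, for every $A\in D_k$, the $m$ largest eigenvalues (counted with multiplicity) of $P_n(A\otimes I_n)P_n$ all converge, as $n\to\infty$, to a common limit, denoted $f(A)$. In that case put $$K=\{B\in D_k:\ \mathrm{Tr}[BA]\le f(A)\ \text{ for all } A\in D_k\},$$ and let $K^\circ$ be the interior of $K$ in the $(k^2-1)$-dimensional real affine space of Hermitian matrices of trace one in $M_k$. Let $V_n:\mathbb C^{N(n)}\to\mathbb C^k\otimes\mathbb C^n$ be any isometries with $V_nV_n^*=P_n$, let $\Phi_n:M_{N(n)}\to M_k$, $\Phi_n(X)=(\mathrm{id}_k\otimes \mathrm{Tr}_n)(V_nXV_n^*)$, be the associated quantum channels, and let $L_n=\Phi_n(D^p_{N(n)})$ be the (in general non-convex) image of the set $D^p_{N(n)}$ of pure states, i.e. of the rank-one self-adjoint projections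 in $M_{N(n)}$. For sets $S_n$ write $$\varliminf_{n\to\infty} S_n=\bigcup_{r}\bigcap_{n\ge r}S_n,\qquad \varlimsup_{n\to\infty} S_n=\bigcap_{r}\bigcup_{n\ge r}S_n .$$ **Theorem.** If $(P_n)$ satisfies condition $\mathcal C_m$ with $m=(2k^2-3)k^2+1$ (for $k=1$, where this number is $0$, with $m=1$), then $$K^\circ\subseteq\varliminf_{n\to\infty}L_n\subseteq\varlimsup_{n\to\infty}L_n\subseteq K.$$ -/

import Mathlib

open Filter Topology
open scoped Kronecker Matrix ComplexOrder

/-- The set `D_k` of states (density matrices) in `M_k(ℂ)`: positive semidefinite, trace one. -/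
def states (k : ℕ) : Set (Matrix (Fin k) (Fin k) ℂ) :=
  {A | A.PosSemidef ∧ A.trace = 1}

/-- The set `D_N^p` of pure states: rank-one self-adjoint projections in `M_N(ℂ)`. -/
def pureStates (N : ℕ) : Set (Matrix (Fin N) (Fin N) ℂ) :=
  {ρ | IsStarProjection ρ ∧ ρ.rank = 1}

/-- The partial trace `id_k ⊗ Tr_n : M_k ⊗ M_n → M_k` over the environment. -/
def partialTraceEnv {k n : ℕ} (X : Matrix (Fin k × Fin n) (Fin k × Fin n) ℂ) :
    Matrix (Fin k) (Fin k) ℂ :=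
  Matrix.of fun i j => ∑ a : Fin n, X (i, a) (j, a)

/-- The channel `Φ : M_N → M_k`, `Φ(X) = (id_k ⊗ Tr_n)(V X V*)`, defined by
`V : ℂ^N → ℂ^k ⊗ ℂ^n` (which will be an isometry). -/
def stinespringChannel {k n N : ℕ} (V : Matrix (Fin k × Fin n) (Fin N) ℂ)
    (X : Matrix (Fin N) (Fin N) ℂ) : Matrix (Fin k) (Fin k) ℂ :=
  partialTraceEnv (V * X * Vᴴ)

/-- The image `L = Φ(D_N^p)` of all pure states. -/
def pureOutputs {k n N : ℕ} (V : Matrix (Fin k × Fin n) (Fin N) ℂ) :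
    Set (Matrix (Fin k) (Fin k) ℂ) :=
  stinespringChannel V '' pureStates N

open Classical in
/-- The `i`-th largest eigenvalue of a Hermitian matrix, counted with multiplicity and with
`i` starting from `0` (`Matrix.IsHermitian.eigenvalues₀` lists the eigenvalues in decreasing
order). The value is `0` if the matrix is not Hermitian or `i` is not less than its size. -/
noncomputable def nthEigenvalue {ι : Type*} [Fintype ι] (M : Matrix ι ι ℂ) (i : ℕ) : ℝ :=
  if h : M.IsHermitian ∧ i < Fintype.card ι then h.1.eigenvalues₀ ⟨i, h.2⟩ else 0

/-- Condition `C_m` for `P_n ∈ M_{kn}`, with limit function `f`: for every state `A ∈ D_k`, the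
`m` largest eigenvalues of `P_n (A ⊗ I_n) P_n` all converge to `f A` as `n → ∞`.
(For `m ≥ 1`, `f` is determined on `D_k`. For `k ≥ 1` only finitely many `n` have `k n < m`.) -/
def ConditionC {k : ℕ} (m : ℕ) (P : ∀ n : ℕ, Matrix (Fin k × Fin n) (Fin k × Fin n) ℂ)
    (f : Matrix (Fin k) (Fin k) ℂ → ℝ) : Prop :=
  ∀ A ∈ states k, ∀ i < m,
    Tendsto (fun n => nthEigenvalue (P n * (A ⊗ₖ (1 : Matrix (Fin n) (Fin n) ℂ)) * P n) i)
      atTop (𝓝 (f A))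

/-- `K = {B ∈ D_k : Tr[BA] ≤ f(A) for all A ∈ D_k}` (these traces are real). -/
def limitSet {k : ℕ} (f : Matrix (Fin k) (Fin k) ℂ → ℝ) : Set (Matrix (Fin k) (Fin k) ℂ) :=
  {B | B ∈ states k ∧ ∀ A ∈ states k, (B * A).trace.re ≤ f A}

/-- The real affine space, of dimension `k² - 1`, of Hermitian `k × k` matrices of trace one. -/
def traceOneHermitian (k : ℕ) : Set (Matrix (Fin k) (Fin k) ℂ) :=
  {A | A.IsHermitian ∧ A.trace = 1}

/-- The interior of a set of states, in the affine space of Hermitian matrices of trace one. -/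
def stateInterior {k : ℕ} (S : Set (Matrix (Fin k) (Fin k) ℂ)) :
    Set (Matrix (Fin k) (Fin k) ℂ) :=
  Subtype.val '' interior {B : traceOneHermitian k | (B : Matrix (Fin k) (Fin k) ℂ) ∈ S}

/-- The set-theoretic lower limit `⋃_N ⋂_{n ≥ N} S_n`. -/
def setLiminf {α : Type*} (S : ℕ → Set α) : Set α := ⋃ N, ⋂ n ≥ N, S n

/-- The set-theoretic upper limit `⋂_N ⋃_{n ≥ N} S_n`. -/
def setLimsup {α : Type*} (S : ℕ → Set α) : Set α := ⋂ N, ⋃ n ≥ N, S n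

/-!
A unit vector `x` in the range of `P n` has the reduced state `(id ⊗ Tr)(|x⟩⟨x|)`, and these reduced
states are exactly the outputs of pure states. For an output `B` and a state `A`, `Tr[BA]` is at most
the largest eigenvalue of `P n (A ⊗ 1) P n`, which tends to `f A`; hence every `B` that is an output
for infinitely many `n` lies in `K` (`setLimsup_pureOutputs_subset`).

For the lower inclusion let `b` be interior to `K`, and let `d = k² - 1` be the dimension of the space
of Hermitian matrices of trace one. By Straszewicz's theorem `K` is the closed convex hull of its
exposed points, and by Steinitz's theorem `2 d` of them (one if `k = 1`) contain `b` in their convex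
hull, stably under small perturbations (`exists_exposedPoints_convexHull_stable`). Each of these points `E i`
is exposed by a functional `Tr[· A i]` with `A i` a positive definite state
(`exists_exposed_states`), so `f (A i) > 0`. For large `n`, the `m` leading eigenvectors of
`P n (A i ⊗ 1) P n` therefore lie in the range of `P n`, and each unit vector in their span has a
reduced state `Y` with `Tr[Y (A i)]` close to `f (A i)`. By compactness of the set of states such
reduced states converge to `E i` (`tendsto_of_exposed`).

The images of pure states are not convex, but mixtures of the chosen reduced states can be
realized. Since `m > (2 d - 1) k²`, the vectors `x i` can be chosen one after the other so that all
cross terms `(id ⊗ Tr)(|x i⟩⟨x j|)` vanish: each earlier vector costs `k²` linear conditions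
(`exists_unit_vectors_partialTraceEnv_cross_eq_zero`). Then `∑ √(t i) x i` has the reduced state
`∑ t i Y i` (`partialTraceEnv_superposition`), and suitable weights `t` give exactly `b`.
-/

/-! ### Exposed points and stable convex hulls -/

section ConvexGeometry

variable {F : Type*} [NormedAddCommGroup F] [InnerProductSpace ℝ F]

open scoped RealInnerProductSpace

/-- A point of `K` at maximal distance from some centre `z` is exposed, by the functional
`⟪p - z, ·⟫`. -/
theorem mem_exposedPoints_of_farthest {K : Set F} {p z : F} (hp : p ∈ K)
    (h : ∀ q ∈ K, ‖q - z‖ ≤ ‖p - z‖) : p ∈ K.exposedPoints ℝ := by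
  have key : ∀ q ∈ K, ‖q - p‖ ^ 2 + 2 * ⟪p - z, q - p⟫ ≤ 0 := fun q hq => by
    have h1 : ‖q - z‖ ^ 2 ≤ ‖p - z‖ ^ 2 := by gcongr; exact h q hq
    have h2 : q - z = (q - p) + (p - z) := by abel
    rw [h2, norm_add_sq_real, real_inner_comm] at h1
    linarith
  refine ⟨hp, innerSL ℝ (p - z), fun q hq => ?_⟩
  have h1 := key q hq
  simp only [innerSL_apply_apply]
  rw [inner_sub_right] at h1
  refine ⟨by nlinarith [sq_nonneg ‖q - p‖], fun h2 => ?_⟩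
  have : ‖q - p‖ ^ 2 ≤ 0 := by linarith
  exact sub_eq_zero.1 (norm_eq_zero.1 (pow_eq_zero_iff two_ne_zero |>.1
    (le_antisymm this (sq_nonneg _))))

theorem exists_weights_of_mem_convexHull_range {ι : Type*} [Fintype ι] {y : ι → F} {x : F}
    (hx : x ∈ convexHull ℝ (Set.range y)) :
    ∃ c : ι → ℝ, (∀ i, 0 ≤ c i) ∧ ∑ i, c i = 1 ∧ ∑ i, c i • y i = x := by
  classical
  have h : Set.range y = (Fintype.linearCombination ℝ y) ''
      Set.range (fun i j : ι => if i = j then (1 : ℝ) else 0) := by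
    rw [← Set.range_comp]
    congr 1
    ext i
    simp [Fintype.linearCombination_apply]
  rw [h, ← LinearMap.image_convexHull, convexHull_basis_eq_stdSimplex] at hx
  obtain ⟨c, ⟨hc0, hc1⟩, hc⟩ := hx
  exact ⟨c, hc0, hc1, by rwa [Fintype.linearCombination_apply] at hc⟩

/-- Carathéodory's theorem for cones. -/
theorem exists_linearIndependent_conic_combination (t : Finset F) (c : F → ℝ)
    (hc : ∀ i ∈ t, 0 ≤ c i) :
    ∃ t' ⊆ t, ∃ c' : F → ℝ, LinearIndependent ℝ ((↑) : t' → F) ∧ (∀ i ∈ t', 0 ≤ c' i) ∧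
      ∑ i ∈ t', c' i • i = ∑ i ∈ t, c i • i := by
  classical
  induction t using Finset.strongInduction generalizing c with
  | H t ih =>
  by_cases hli : LinearIndependent ℝ ((↑) : t → F)
  · exact ⟨t, subset_rfl, c, hli, hc, rfl⟩
  obtain ⟨g, hg0, i₁, hi₁, hgi₁⟩ : ∃ g : F → ℝ, ∑ i ∈ t, g i • i = 0 ∧ ∃ i ∈ t, 0 < g i := by
    have : ¬ LinearIndepOn ℝ id (t : Set F) := hli
    rw [linearIndepOn_finset_iff] at this
    push Not at this
    obtain ⟨g, hg, i, hi, hgi⟩ := this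
    simp only [id] at hg
    rcases lt_or_gt_of_ne hgi with h | h
    · exact ⟨-g, by simpa using hg, i, hi, by simpa using h⟩
    · exact ⟨g, hg, i, hi, h⟩
  -- subtract the multiple of the relation `g` that makes the first coefficient vanish
  obtain ⟨i₀, hi₀, hmin⟩ := (t.filter fun i => 0 < g i).exists_min_image (fun i => c i / g i)
    ⟨i₁, by simp [hi₁, hgi₁]⟩
  simp only [Finset.mem_filter] at hi₀ hmin
  obtain ⟨hi₀, hgi₀⟩ := hi₀
  set q := c i₀ / g i₀ with hq
  have hq0 : 0 ≤ q := div_nonneg (hc _ hi₀) hgi₀.le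
  obtain ⟨t', ht', c', hli', hc', hsum⟩ := ih (t.erase i₀) (Finset.erase_ssubset hi₀)
    (fun i => c i - q * g i) (fun i hi => by
      have hi := Finset.mem_of_mem_erase hi
      rcases le_or_gt (g i) 0 with h | h
      · nlinarith [hc i hi]
      · have := (le_div_iff₀ h).1 (hmin i ⟨hi, h⟩)
        linarith)
  refine ⟨t', ht'.trans (Finset.erase_subset _ _), c', hli', hc', ?_⟩
  have hz : c i₀ - q * g i₀ = 0 := by rw [hq]; field_simp; ring
  rw [hsum, Finset.sum_erase _ (by simp [hz])]
  simp only [sub_smul, Finset.sum_sub_distrib, mul_smul, ← Finset.smul_sum, hg0, smul_zero,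
    sub_zero]

variable [FiniteDimensional ℝ F]

/-- **Straszewicz's theorem**, in the form needed here. If `y ∈ K` could be separated from the
exposed points, a large ball would contain the exposed points but not `y`, whereas the point of `K`
farthest from the centre of that ball is exposed. -/
theorem subset_closure_convexHull_exposedPoints {K : Set F} (hK : IsCompact K) :
    K ⊆ closure (convexHull ℝ (K.exposedPoints ℝ)) := by
  intro y hy
  by_contra hyC
  obtain ⟨f, u, hfu, huy⟩ := geometric_hahn_banach_closed_point
    (convex_convexHull ℝ (K.exposedPoints ℝ)).closure isClosed_closure hyC
  set v := (InnerProductSpace.toDual ℝ F).symm f with hv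
  have hfv : ∀ a, f a = ⟪v, a⟫ := fun a => by simp [hv]
  obtain ⟨D, hD⟩ := hK.isBounded.exists_norm_le
  set δ := f y - u with hδ
  have hδ0 : 0 < δ := by simp [hδ, huy]
  set t := (2 * D) ^ 2 / (2 * δ) + 1 with ht
  have ht0 : 0 < t := by positivity
  obtain ⟨p, hp, hmax⟩ := hK.exists_isMaxOn ⟨y, hy⟩
    (f := fun q => ‖q - (y - t • v)‖) (by fun_prop)
  have hpe := mem_exposedPoints_of_farthest hp fun q hq => hmax hq
  have h1 : ‖y - (y - t • v)‖ ^ 2 ≤ ‖p - (y - t • v)‖ ^ 2 := by gcongr; exact hmax hy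
  have h2 : p - (y - t • v) = (p - y) + t • v := by abel
  have h3 : f p < u := hfu p (subset_closure (subset_convexHull ℝ _ hpe))
  have h4 : ‖p - y‖ ^ 2 ≤ (2 * D) ^ 2 := by
    gcongr
    calc ‖p - y‖ ≤ ‖p‖ + ‖y‖ := norm_sub_le _ _
      _ ≤ 2 * D := by linarith [hD p hp, hD y hy]
  rw [h2, norm_add_sq_real, sub_sub_cancel, inner_smul_right, real_inner_comm, inner_sub_right,
    ← hfv, ← hfv] at h1
  have h5 : 2 * t * δ = (2 * D) ^ 2 + 2 * δ := by rw [ht]; field_simp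
  nlinarith

/-- If the vectors `s i` positively span `F`, then `0` stays in the convex hull of every small
perturbation of them. -/
theorem exists_zero_mem_convexHull_of_dist_lt {ι : Type*} [Finite ι] [Nonempty ι] (s : ι → F)
    (h : ∀ v : F, v ≠ 0 → ∃ i, 0 < ⟪v, s i⟫) :
    ∃ ε > 0, ∀ y : ι → F, (∀ i, dist (y i) (s i) < ε) → 0 ∈ convexHull ℝ (Set.range y) := by
  cases nonempty_fintype ι
  obtain ⟨ε, hε, hmin⟩ := (isCompact_sphere (0 : F) 1).exists_forall_le' (a := (0 : ℝ))
    (f := fun v => Finset.univ.sup' Finset.univ_nonempty fun i => ⟪v, s i⟫)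
    (Continuous.continuousOn (Continuous.finset_sup'_apply _ fun i _ => by fun_prop))
    (fun v hv => by
      obtain ⟨i, hi⟩ := h v (ne_zero_of_mem_unit_sphere ⟨v, hv⟩)
      exact hi.trans_le (Finset.le_sup' (fun i => ⟪v, s i⟫) (Finset.mem_univ i)))
  refine ⟨ε, hε, fun y hy => ?_⟩
  by_contra h0
  obtain ⟨f, u, hfu, hu0⟩ := geometric_hahn_banach_closed_point (convex_convexHull ℝ _)
    ((Set.finite_range y).isCompact_convexHull ℝ).isClosed h0
  rw [map_zero] at hu0
  set v := (InnerProductSpace.toDual ℝ F).symm f with hv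
  have hfv : ∀ a, f a = ⟪v, a⟫ := fun a => by simp [hv]
  have hneg : ∀ i, ⟪v, y i⟫ < 0 := fun i =>
    hfv (y i) ▸ (hfu _ (subset_convexHull ℝ _ ⟨i, rfl⟩)).trans hu0
  have hv0 : v ≠ 0 := fun h => by
    obtain ⟨i⟩ := ‹Nonempty ι›
    simpa [h] using hneg i
  have hvn : 0 < ‖v‖ := norm_pos_iff.2 hv0
  obtain ⟨i, -, hi⟩ := Finset.exists_mem_eq_sup' Finset.univ_nonempty
    fun i => ⟪‖v‖⁻¹ • v, s i⟫
  have h1 := hmin (‖v‖⁻¹ • v) (by simp [norm_smul, hvn.ne'])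
  rw [hi, inner_smul_left] at h1
  simp only [conj_trivial] at h1
  have h2 : ε * ‖v‖ ≤ ⟪v, s i⟫ := by
    rwa [inv_mul_eq_div, le_div_iff₀ hvn] at h1
  have h3 : ⟪v, s i - y i⟫ ≤ ‖v‖ * ‖s i - y i‖ := real_inner_le_norm _ _
  have h4 : ‖s i - y i‖ < ε := by rw [← dist_eq_norm, dist_comm]; exact hy i
  rw [inner_sub_right] at h3
  nlinarith [hneg i]

/-- **Steinitz's theorem** in dual form: a set that positively spans a `d`-dimensional space has a
positively spanning subset of at most `2 d` vectors. These are a basis `b` contained in the set,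
together with at most `d` vectors whose cone contains `- ∑ b`. -/
theorem exists_finset_positively_spanning (S : Set F)
    (hS : ∀ v : F, v ≠ 0 → ∃ s ∈ S, 0 < ⟪v, s⟫) :
    ∃ R : Finset F, ↑R ⊆ S ∧ R.card ≤ 2 * Module.finrank ℝ F ∧
      ∀ v : F, v ≠ 0 → ∃ s ∈ R, 0 < ⟪v, s⟫ := by
  classical
  rcases subsingleton_or_nontrivial F with hF | hF
  · exact ⟨∅, by simp, by simp, fun v hv => (hv (Subsingleton.elim _ _)).elim⟩
  obtain ⟨S', hS'S, hS'⟩ : ∃ S' : Finset F, ↑S' ⊆ S ∧ ∀ v : F, v ≠ 0 → ∃ s ∈ S', 0 < ⟪v, s⟫ := by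
    obtain ⟨T, hT⟩ := (isCompact_sphere (0 : F) 1).elim_finite_subcover
      (fun s : S => {v : F | 0 < ⟪v, (s : F)⟫})
      (fun s => isOpen_lt continuous_const (by fun_prop))
      (fun v hv => by
        obtain ⟨s, hs, h⟩ := hS v (ne_zero_of_mem_unit_sphere ⟨v, hv⟩)
        exact Set.mem_iUnion.2 ⟨⟨s, hs⟩, h⟩)
    refine ⟨T.image (↑), by simp, fun v hv => ?_⟩
    have hvn : 0 < ‖v‖ := norm_pos_iff.2 hv
    have := hT (show ‖v‖⁻¹ • v ∈ Metric.sphere (0 : F) 1 by simp [norm_smul, hvn.ne'])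
    simp only [Set.mem_iUnion, Set.mem_ofPred_eq, inner_smul_left, conj_trivial] at this
    obtain ⟨s, hs, h⟩ := this
    exact ⟨s, Finset.mem_image_of_mem _ hs, pos_of_mul_pos_right h (by positivity)⟩
  have hne : Nonempty S' := by
    obtain ⟨v, hv⟩ := exists_ne (0 : F)
    obtain ⟨s, hs, -⟩ := hS' v hv
    exact ⟨s, hs⟩
  have hspan : Submodule.span ℝ (S' : Set F) = ⊤ := by
    by_contra h
    have h' : (Submodule.span ℝ (S' : Set F))ᗮ ≠ ⊥ := by
      rwa [ne_eq, Submodule.orthogonal_eq_bot_iff]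
    obtain ⟨v, hv, hv0⟩ := Submodule.exists_mem_ne_zero_of_ne_bot h'
    obtain ⟨s, hs, h⟩ := hS' v hv0
    rw [Submodule.inner_left_of_mem_orthogonal (Submodule.subset_span hs) hv] at h
    exact h.false
  obtain ⟨b, hbS, hbspan, hbli⟩ := exists_linearIndependent ℝ (S' : Set F)
  lift b to Finset F using S'.finite_toSet.subset hbS
  set w := -∑ x ∈ b, x with hw
  obtain ⟨ε, hε, hrob⟩ := exists_zero_mem_convexHull_of_dist_lt (fun s : S' => (s : F))
    fun v hv => by simpa using hS' v hv
  -- perturbing by the small multiple `η w` shows that `η w` is a convex combination of `S'`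
  set η := ε / (2 * (‖w‖ + 1)) with hη
  have hη0 : 0 < η := by positivity
  have hηw : ‖η • w‖ < ε := by
    rw [norm_smul, Real.norm_of_nonneg hη0.le, hη, div_mul_eq_mul_div, div_lt_iff₀ (by positivity)]
    nlinarith [norm_nonneg w]
  have h0 := hrob (fun s => s - η • w) (fun s => by simpa [dist_eq_norm] using hηw)
  obtain ⟨c, hc0, hc1, hcw⟩ := exists_weights_of_mem_convexHull_range h0
  have hcw' : ∑ s ∈ S', (Function.extend ((↑) : S' → F) c (fun _ => 0) s / η) • s = w := by
    rw [← Finset.sum_coe_sort]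
    simp only [Subtype.val_injective.extend_apply, smul_sub, Finset.sum_sub_distrib,
      ← Finset.sum_smul, hc1, one_smul, sub_eq_zero] at hcw ⊢
    simp only [div_eq_inv_mul, mul_smul, ← Finset.smul_sum, hcw]
    rw [inv_smul_smul₀ hη0.ne']
  obtain ⟨u, huS, c', huli, hc'0, hc'⟩ := exists_linearIndependent_conic_combination S'
    (fun s => Function.extend ((↑) : S' → F) c (fun _ => 0) s / η) (fun s hs => by
      have := Subtype.val_injective.extend_apply c (fun _ => 0) ⟨s, hs⟩
      simp only at this
      rw [this]
      exact div_nonneg (hc0 _) hη0.le)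
  rw [hcw'] at hc'
  refine ⟨b ∪ u, ?_, ?_, fun v hv => ?_⟩
  · rw [Finset.coe_union]
    exact (Set.union_subset hbS (Finset.coe_subset.2 huS)).trans hS'S
  · have h1 := hbli.fintype_card_le_finrank
    have h2 := huli.fintype_card_le_finrank
    simp only [Fintype.card_coe, Finset.coe_sort_coe] at h1 h2
    have := Finset.card_union_le b u
    omega
  · by_contra! hcon
    have hb0 : ∀ x ∈ b, ⟪v, x⟫ ≤ 0 := fun x hx => hcon x (Finset.mem_union_left _ hx)
    have hw0 : ⟪v, w⟫ ≤ 0 := by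
      rw [← hc', inner_sum]
      refine Finset.sum_nonpos fun x hx => ?_
      rw [inner_smul_right]
      exact mul_nonpos_of_nonneg_of_nonpos (hc'0 x hx) (hcon x (Finset.mem_union_right _ hx))
    rw [hw, inner_neg_right, inner_sum, neg_nonpos] at hw0
    have hbz : ∀ x ∈ b, ⟪v, x⟫ = 0 :=
      (Finset.sum_eq_zero_iff_of_nonpos hb0).1 (le_antisymm (Finset.sum_nonpos hb0) hw0)
    have hvorth : v ∈ (Submodule.span ℝ (b : Set F))ᗮ := by
      rw [Submodule.mem_orthogonal']
      intro x hx
      induction hx using Submodule.span_induction with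
      | mem x hx => exact hbz x hx
      | zero => simp
      | add x y _ _ hx hy => rw [inner_add_right, hx, hy, add_zero]
      | smul a x _ hx => rw [inner_smul_right, hx, mul_zero]
    rw [hbspan, hspan, Submodule.top_orthogonal_eq_bot, Submodule.mem_bot] at hvorth
    exact hv hvorth

/-- If the origin is interior to a compact set `K`, then there are `2 d` exposed points of `K` (one
if `d = 0`) such that the origin stays in the convex hull of every small perturbation of them. -/
theorem exists_exposedPoints_convexHull_stable {K : Set F} (hK : IsCompact K)
    (h0 : (0 : F) ∈ interior K) {r : ℕ} (hr : 2 * Module.finrank ℝ F ≤ r) (hr1 : 1 ≤ r) :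
    ∃ E : Fin r → F, (∀ i, E i ∈ K.exposedPoints ℝ) ∧ ∃ ε > 0, ∀ y : Fin r → F,
      (∀ i, dist (y i) (E i) < ε) → 0 ∈ convexHull ℝ (Set.range y) := by
  have hdense := subset_closure_convexHull_exposedPoints hK
  obtain ⟨e₀, he₀⟩ : (K.exposedPoints ℝ).Nonempty := by
    rw [← convexHull_nonempty_iff (𝕜 := ℝ), ← closure_nonempty_iff]
    exact ⟨0, hdense (interior_subset h0)⟩
  have hS : ∀ v : F, v ≠ 0 → ∃ s ∈ K.exposedPoints ℝ, 0 < ⟪v, s⟫ := by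
    intro v hv
    by_contra! hcon
    have hhalf : closure (convexHull ℝ (K.exposedPoints ℝ)) ⊆ {x | ⟪v, x⟫ ≤ 0} := by
      refine closure_minimal (convexHull_min hcon ?_) (isClosed_le (by fun_prop) (by fun_prop))
      exact convex_halfSpace_le (innerSL ℝ v).isLinear 0
    have hlim : Tendsto (fun t : ℝ => t • v) (𝓝[>] 0) (𝓝 0) := by
      have : Continuous fun t : ℝ => t • v := by fun_prop
      simpa using (this.tendsto 0).mono_left nhdsWithin_le_nhds
    obtain ⟨t, htK, ht⟩ := ((hlim.eventually (mem_interior_iff_mem_nhds.1 h0)).and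
      self_mem_nhdsWithin).exists
    have h1 : ⟪v, t • v⟫ ≤ 0 := hhalf (hdense htK)
    rw [inner_smul_right] at h1
    have h2 : 0 < ⟪v, v⟫ := real_inner_self_pos.2 hv
    have : 0 < t * ⟪v, v⟫ := mul_pos ht h2
    linarith
  obtain ⟨R, hRS, hRcard, hR⟩ := exists_finset_positively_spanning _ hS
  -- list `R` as a family indexed by `Fin r`, padded with `e₀`
  let E : Fin r → F := fun i => if h : (i : ℕ) < R.card then R.equivFin.symm ⟨i, h⟩ else e₀
  have hE : ∀ s ∈ R, ∃ i, E i = s := fun s hs => by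
    have hlt := (R.equivFin ⟨s, hs⟩).2
    exact ⟨⟨R.equivFin ⟨s, hs⟩, hlt.trans_le (hRcard.trans hr)⟩, by simp [E]⟩
  refine ⟨E, fun i => ?_, ?_⟩
  · by_cases h : (i : ℕ) < R.card
    · simp only [E, h, dif_pos]
      exact hRS (R.equivFin.symm _).2
    · simpa only [E, h, dif_neg, not_false_eq_true] using he₀
  · have : Nonempty (Fin r) := ⟨⟨0, hr1⟩⟩
    refine exists_zero_mem_convexHull_of_dist_lt E fun v hv => ?_
    obtain ⟨s, hs, h⟩ := hR v hv
    obtain ⟨i, rfl⟩ := hE s hs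
    exact ⟨i, h⟩

end ConvexGeometry

/-! ### Positive semidefinite matrices, partial traces and outputs of pure states -/

section PositiveMatrices

open Matrix

variable {ι : Type*} [Fintype ι]

open scoped MatrixOrder in
theorem re_trace_mul_nonneg {A B : Matrix ι ι ℂ} (hA : A.PosSemidef) (hB : B.PosSemidef) :
    0 ≤ (A * B).trace.re := by
  classical
  obtain ⟨C, rfl⟩ := CStarAlgebra.nonneg_iff_eq_star_mul_self.1 hB.nonneg
  rw [← mul_assoc, trace_mul_comm, ← mul_assoc, star_eq_conjTranspose]
  exact (Complex.nonneg_iff.1 (hA.mul_mul_conjTranspose_same C).trace_nonneg).1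

theorem trace_eq_one_of_mem_pureStates {N : ℕ} {ρ : Matrix (Fin N) (Fin N) ℂ}
    (hρ : ρ ∈ pureStates N) : ρ.trace = 1 := by
  have hid : IsIdempotentElem (toLin' ρ) := by
    rw [IsIdempotentElem, ← LinearMap.toMatrix'.injective.eq_iff]
    simpa [LinearMap.toMatrix'_mul] using hρ.1.isIdempotentElem.eq
  have h := (LinearMap.IsIdempotentElem.isProj_range _ hid).trace
  rw [Matrix.trace_toLin'_eq] at h
  have h2 : Module.finrank ℂ (LinearMap.range (toLin' ρ)) = 1 := hρ.2
  rw [h, h2, Nat.cast_one]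

theorem posSemidef_of_isStarProjection {A : Matrix ι ι ℂ} (hA : IsStarProjection A) :
    A.PosSemidef := by
  classical
  have h := posSemidef_conjTranspose_mul_self A
  rwa [← star_eq_conjTranspose, hA.isSelfAdjoint.star_eq, hA.isIdempotentElem.eq] at h

/-- A Hermitian matrix has orthonormal eigenvectors, the columns of `W`, for its `m` largest
eigenvalues. -/
theorem exists_isometry_top_eigenvectors {T : Matrix ι ι ℂ} (hT : T.IsHermitian) {m : ℕ}
    (hm : m ≤ Fintype.card ι) :
    ∃ W : Matrix ι (Fin m) ℂ, Wᴴ * W = 1 ∧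
      T * W = W * diagonal fun j : Fin m => (nthEigenvalue T j : ℂ) := by
  classical
  let σ : Fin m → ι := fun j => Fintype.equivOfCardEq (Fintype.card_fin _) (Fin.castLE hm j)
  have hσ : Function.Injective σ :=
    (Equiv.injective _).comp (Fin.castLE_injective hm)
  have hval : ∀ j, hT.eigenvalues (σ j) = nthEigenvalue T j := fun j => by
    rw [nthEigenvalue, dif_pos ⟨hT, j.2.trans_le hm⟩]
    simp only [IsHermitian.eigenvalues, σ, Equiv.symm_apply_apply]
    rw [show Fin.castLE hm j = ⟨j, j.2.trans_le hm⟩ from rfl]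
  refine ⟨(hT.eigenvectorUnitary : Matrix ι ι ℂ).submatrix id σ, ?_, ?_⟩
  · have h : (hT.eigenvectorUnitary : Matrix ι ι ℂ)ᴴ * hT.eigenvectorUnitary = 1 :=
      Unitary.coe_star_mul_self hT.eigenvectorUnitary
    rw [conjTranspose_submatrix, ← submatrix_mul _ _ _ _ _ Function.bijective_id, h]
    exact submatrix_one σ hσ
  · ext i j
    have h := congrFun (hT.mulVec_eigenvectorBasis (σ j)) i
    rw [mul_diagonal, ← hval]
    simpa [mul_apply, mulVec, dotProduct, mul_comm] using h

/-- The largest eigenvalue bounds the matrix from above in the Loewner order. -/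
theorem posSemidef_nthEigenvalue_zero_sub [DecidableEq ι] {T : Matrix ι ι ℂ}
    (hT : T.IsHermitian) : ((nthEigenvalue T 0 : ℂ) • (1 : Matrix ι ι ℂ) - T).PosSemidef := by
  have hle : ∀ i, hT.eigenvalues i ≤ nthEigenvalue T 0 := fun i => by
    have hpos : 0 < Fintype.card ι := Fintype.card_pos_iff.2 ⟨i⟩
    rw [nthEigenvalue, dif_pos ⟨hT, hpos⟩]
    have h : hT.eigenvalues i ≤ hT.eigenvalues₀ ⟨0, hpos⟩ :=
      hT.eigenvalues₀_antitone (Fin.mk_le_of_le_val (Nat.zero_le _))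
    convert h
  set U : Matrix ι ι ℂ := hT.eigenvectorUnitary.1 with hU
  have hUU : U * Uᴴ = 1 := Unitary.coe_mul_star_self _
  have hspec : T = U * diagonal (fun i => (hT.eigenvalues i : ℂ)) * Uᴴ := by
    have := hT.spectral_theorem
    rw [Unitary.conjStarAlgAut_apply] at this
    exact this
  have hd : (diagonal fun i => ((nthEigenvalue T 0 - hT.eigenvalues i : ℝ) : ℂ)).PosSemidef :=
    PosSemidef.diagonal fun i => by
      simpa using hle i
  convert hd.mul_mul_conjTranspose_same U using 1
  have : (diagonal fun i => ((nthEigenvalue T 0 - hT.eigenvalues i : ℝ) : ℂ)) =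
      (nthEigenvalue T 0 : ℂ) • (1 : Matrix ι ι ℂ) -
        diagonal (fun i => (hT.eigenvalues i : ℂ)) := by
    rw [smul_one_eq_diagonal, diagonal_sub]
    simp
  rw [this, mul_sub, sub_mul, ← hspec, Matrix.mul_smul, mul_one, Matrix.smul_mul, hUU]

end PositiveMatrices

section PartialTrace

open Matrix

variable {k n : ℕ}

theorem partialTraceEnv_sum {ι : Type*} (s : Finset ι)
    (X : ι → Matrix (Fin k × Fin n) (Fin k × Fin n) ℂ) :
    partialTraceEnv (∑ i ∈ s, X i) = ∑ i ∈ s, partialTraceEnv (X i) := by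
  ext a b
  simp only [partialTraceEnv, of_apply, Matrix.sum_apply]
  exact Finset.sum_comm

theorem partialTraceEnv_smul (c : ℂ) (X : Matrix (Fin k × Fin n) (Fin k × Fin n) ℂ) :
    partialTraceEnv (c • X) = c • partialTraceEnv X := by
  ext a b
  simp [partialTraceEnv, Finset.mul_sum]

/-- The partial trace is dual to `A ↦ A ⊗ 1`. -/
theorem trace_partialTraceEnv_mul (X : Matrix (Fin k × Fin n) (Fin k × Fin n) ℂ)
    (A : Matrix (Fin k) (Fin k) ℂ) :
    (partialTraceEnv X * A).trace = (X * (A ⊗ₖ (1 : Matrix (Fin n) (Fin n) ℂ))).trace := by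
  simp only [trace, diag_apply, mul_apply, partialTraceEnv, of_apply, Fintype.sum_prod_type,
    kronecker_apply, one_apply, mul_ite, mul_one, mul_zero, Finset.sum_ite_eq', Finset.mem_univ,
    if_true, Finset.sum_mul]
  exact Finset.sum_congr rfl fun i _ => Finset.sum_comm

theorem trace_partialTraceEnv (X : Matrix (Fin k × Fin n) (Fin k × Fin n) ℂ) :
    (partialTraceEnv X).trace = X.trace := by
  simpa using trace_partialTraceEnv_mul X 1

theorem posSemidef_partialTraceEnv {X : Matrix (Fin k × Fin n) (Fin k × Fin n) ℂ}
    (hX : X.PosSemidef) : (partialTraceEnv X).PosSemidef := by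
  have : partialTraceEnv X = ∑ a : Fin n, X.submatrix (fun i => (i, a)) (fun i => (i, a)) := by
    ext i j
    simp [partialTraceEnv, Matrix.sum_apply]
  rw [this]
  exact posSemidef_sum _ fun a _ => hX.submatrix _

theorem isHermitian_compression {P : Matrix (Fin k × Fin n) (Fin k × Fin n) ℂ}
    (hP : IsStarProjection P) {A : Matrix (Fin k) (Fin k) ℂ} (hA : A.IsHermitian) :
    (P * (A ⊗ₖ (1 : Matrix (Fin n) (Fin n) ℂ)) * P).IsHermitian := by
  have hPs : Pᴴ = P := hP.isSelfAdjoint.star_eq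
  rw [IsHermitian, conjTranspose_mul, conjTranspose_mul, conjTranspose_kronecker, hPs, hA.eq,
    conjTranspose_one, mul_assoc]

variable {N : ℕ} {V : Matrix (Fin k × Fin n) (Fin N) ℂ}
  {P : Matrix (Fin k × Fin n) (Fin k × Fin n) ℂ}

theorem mem_states_of_mem_pureOutputs (hV : Vᴴ * V = 1) {B : Matrix (Fin k) (Fin k) ℂ}
    (hB : B ∈ pureOutputs V) : B ∈ states k := by
  obtain ⟨ρ, hρ, rfl⟩ := hB
  refine ⟨posSemidef_partialTraceEnv
    ((posSemidef_of_isStarProjection hρ.1).mul_mul_conjTranspose_same V), ?_⟩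
  rw [stinespringChannel, trace_partialTraceEnv, trace_mul_cycle, hV, one_mul,
    trace_eq_one_of_mem_pureStates hρ]

theorem re_trace_mul_le_of_mem_pureOutputs (hV : Vᴴ * V = 1) (hP : IsStarProjection P)
    (hVP : V * Vᴴ = P) {B : Matrix (Fin k) (Fin k) ℂ} (hB : B ∈ pureOutputs V)
    {A : Matrix (Fin k) (Fin k) ℂ} (hA : A ∈ states k) :
    (B * A).trace.re ≤
      nthEigenvalue (P * (A ⊗ₖ (1 : Matrix (Fin n) (Fin n) ℂ)) * P) 0 := by
  have hBtr := (mem_states_of_mem_pureOutputs hV hB).2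
  obtain ⟨ρ, hρ, rfl⟩ := hB
  rw [stinespringChannel] at hBtr ⊢
  set X := V * ρ * Vᴴ with hX
  set T := P * (A ⊗ₖ (1 : Matrix (Fin n) (Fin n) ℂ)) * P with hT
  have hPX : P * X * P = X := by
    rw [← hVP, hX]
    calc V * Vᴴ * (V * ρ * Vᴴ) * (V * Vᴴ) = V * (Vᴴ * V) * ρ * (Vᴴ * V) * Vᴴ := by
          simp only [Matrix.mul_assoc]
      _ = V * ρ * Vᴴ := by rw [hV, Matrix.mul_one, Matrix.mul_one]
  have hXT : (partialTraceEnv X * A).trace = (X * T).trace := by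
    rw [trace_partialTraceEnv_mul]
    conv_lhs => rw [← hPX]
    rw [hT, mul_assoc P X P, mul_assoc, trace_mul_comm]
    simp only [mul_assoc]
  have h := re_trace_mul_nonneg
    ((posSemidef_of_isStarProjection hρ.1).mul_mul_conjTranspose_same V)
    (posSemidef_nthEigenvalue_zero_sub (isHermitian_compression hP hA.1.1))
  rw [← hX, ← hT, mul_sub, trace_sub, Matrix.mul_smul, mul_one, trace_smul, ← trace_partialTraceEnv,
    hBtr, ← hXT] at h
  simpa using h

/-- The reduced state of a unit vector in the range of `V Vᴴ` is an output of a pure state. -/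
theorem partialTraceEnv_vecMulVec_mem_pureOutputs (hV : Vᴴ * V = 1)
    {x : Fin k × Fin n → ℂ} (hx : (V * Vᴴ) *ᵥ x = x) (hx1 : x ⬝ᵥ star x = 1) :
    partialTraceEnv (vecMulVec x (star x)) ∈ pureOutputs V := by
  obtain ⟨v, hv⟩ : ∃ v, v = Vᴴ *ᵥ x := ⟨_, rfl⟩
  have hVv : V *ᵥ v = x := by rw [hv, mulVec_mulVec, hx]
  have hstar : star v ᵥ* Vᴴ = star x := by rw [← star_mulVec, hVv]
  have hv1 : star v ⬝ᵥ v = 1 := by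
    have : star v ⬝ᵥ v = star v ᵥ* Vᴴ ⬝ᵥ (V *ᵥ v) := by
      rw [dotProduct_mulVec, vecMul_vecMul, hV, vecMul_one]
    rw [this, hstar, hVv, dotProduct_comm, hx1]
  refine ⟨vecMulVec v (star v), ⟨⟨?_, ?_⟩, ?_⟩, ?_⟩
  · rw [IsIdempotentElem, vecMulVec_mul_vecMulVec, hv1, one_smul]
  · exact (posSemidef_vecMulVec_self_star v).1
  · refine le_antisymm (rank_vecMulVec_le _ _) (Nat.one_le_iff_ne_zero.2 fun h => ?_)
    rw [rank, Submodule.finrank_eq_zero, LinearMap.range_eq_bot, ← toLin'_apply',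
      map_eq_zero_iff _ toLin'.injective] at h
    have h2 := trace_vecMulVec v (star v)
    rw [h, trace_zero, dotProduct_comm, hv1] at h2
    exact zero_ne_one h2
  · rw [stinespringChannel, mul_vecMulVec, vecMulVec_mul, hVv, hstar]

end PartialTrace

/-! ### Superpositions of vectors with vanishing cross terms -/

section OrthogonalEnvironments

open Matrix

variable {k n : ℕ}

theorem conjTranspose_partialTraceEnv_vecMulVec (x y : Fin k × Fin n → ℂ) :
    (partialTraceEnv (vecMulVec x (star y)))ᴴ = partialTraceEnv (vecMulVec y (star x)) := by
  ext a b
  simp [partialTraceEnv, vecMulVec_apply, mul_comm]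

/-- The cross terms `(id ⊗ Tr)(|x⟩⟨y|)` vanish for suitable vectors `W i c i`, with `c i` a unit
vector, chosen one after the other: each earlier vector imposes `k²` linear conditions on the next
one. -/
theorem exists_unit_vectors_partialTraceEnv_cross_eq_zero {r m : ℕ} (hm : (r - 1) * k ^ 2 < m)
    (W : Fin r → Matrix (Fin k × Fin n) (Fin m) ℂ) :
    ∃ c : Fin r → Fin m → ℂ, (∀ i, star (c i) ⬝ᵥ c i = 1) ∧
      ∀ i j, i ≠ j → partialTraceEnv (vecMulVec (W i *ᵥ c i) (star (W j *ᵥ c j))) = 0 := by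
  suffices h : ∀ s ≤ r, ∃ c : Fin r → Fin m → ℂ,
      (∀ i : Fin r, (i : ℕ) < s → star (c i) ⬝ᵥ c i = 1) ∧
      ∀ i j : Fin r, (i : ℕ) < s → (j : ℕ) < s → i ≠ j →
        partialTraceEnv (vecMulVec (W i *ᵥ c i) (star (W j *ᵥ c j))) = 0 by
    obtain ⟨c, h1, h2⟩ := h r le_rfl
    exact ⟨c, fun i => h1 i i.2, fun i j => h2 i j i.2 j.2⟩
  intro s
  induction s with
  | zero => exact fun _ => ⟨0, by simp, by simp⟩
  | succ s ih =>
    intro hs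
    obtain ⟨c, hc1, hc2⟩ := ih (by omega)
    let i₀ : Fin r := ⟨s, hs⟩
    -- the conditions that the `s` earlier vectors impose on the coefficients of the next one
    let L : (Fin m → ℂ) →ₗ[ℂ] (Fin s → Matrix (Fin k) (Fin k) ℂ) :=
      { toFun := fun u j => partialTraceEnv (vecMulVec (W i₀ *ᵥ u)
          (star (W (Fin.castLE (by omega) j) *ᵥ c (Fin.castLE (by omega) j))))
        map_add' := fun u v => by
          ext j a b
          simp [partialTraceEnv, mulVec_add, vecMulVec_apply, add_mul, Finset.sum_add_distrib]
        map_smul' := fun z u => by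
          ext j a b
          simp [partialTraceEnv, mulVec_smul, vecMulVec_apply, mul_assoc, Finset.mul_sum] }
    have hrank : Module.finrank ℂ (Fin s → Matrix (Fin k) (Fin k) ℂ) <
        Module.finrank ℂ (Fin m → ℂ) := by
      simp only [Module.finrank_pi_fintype, Module.finrank_matrix, Module.finrank_self,
        Fintype.card_fin, Finset.sum_const, Finset.card_univ, smul_eq_mul, mul_one]
      calc s * (k * k) ≤ (r - 1) * k ^ 2 := by rw [sq]; exact Nat.mul_le_mul_right _ (by omega)
        _ < m := hm
    obtain ⟨u, hu, hu0⟩ := Submodule.exists_mem_ne_zero_of_ne_bot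
      (LinearMap.ker_ne_bot_of_finrank_lt (f := L) hrank)
    have hupos : 0 < star u ⬝ᵥ u := dotProduct_star_self_pos_iff.2 hu0
    set t := (star u ⬝ᵥ u).re with ht
    have htu : star u ⬝ᵥ u = (t : ℂ) := Complex.ext (by simp [ht]) (by
      simpa using (Complex.pos_iff.1 hupos).2.symm)
    have ht0 : 0 < t := (Complex.pos_iff.1 hupos).1
    set z : ℂ := (((√t)⁻¹ : ℝ) : ℂ) with hz
    have hLz : L (z • u) = 0 := by rw [map_smul, LinearMap.mem_ker.1 hu, smul_zero]
    have hcross : ∀ j : Fin r, (j : ℕ) < s →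
        partialTraceEnv (vecMulVec (W i₀ *ᵥ (z • u)) (star (W j *ᵥ c j))) = 0 :=
      fun j hj => congrFun hLz ⟨j, hj⟩
    refine ⟨Function.update c i₀ (z • u), fun i hi => ?_, fun i j hi hj hij => ?_⟩
    · by_cases h : i = i₀
      · subst h
        rw [Function.update_self, star_smul, smul_dotProduct, dotProduct_smul, htu, hz]
        simp only [RCLike.star_def, Complex.conj_ofReal, smul_eq_mul, ← Complex.ofReal_mul]
        rw [← mul_assoc, ← mul_inv, Real.mul_self_sqrt ht0.le, inv_mul_cancel₀ ht0.ne',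
          Complex.ofReal_one]
      · rw [Function.update_of_ne h]
        have : (i : ℕ) ≠ s := fun h' => h (Fin.ext h')
        exact hc1 i (by omega)
    · by_cases h : i = i₀ <;> by_cases h' : j = i₀
      · exact absurd (h.trans h'.symm) hij
      · have : (j : ℕ) ≠ s := fun e => h' (Fin.ext e)
        rw [Function.update_of_ne h', h, Function.update_self]
        exact hcross j (by omega)
      · have : (i : ℕ) ≠ s := fun e => h (Fin.ext e)
        rw [Function.update_of_ne h, h', Function.update_self,
          ← conjTranspose_partialTraceEnv_vecMulVec, hcross i (by omega), conjTranspose_zero]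
      · have h1 : (j : ℕ) ≠ s := fun e => h' (Fin.ext e)
        have h2 : (i : ℕ) ≠ s := fun e => h (Fin.ext e)
        rw [Function.update_of_ne h, Function.update_of_ne h']
        exact hc2 i j (by omega) (by omega) hij

/-- A superposition of vectors with vanishing cross terms has the corresponding mixture of reduced
states as its reduced state. -/
theorem partialTraceEnv_superposition {r : ℕ} {x : Fin r → Fin k × Fin n → ℂ}
    (hx : ∀ i j, i ≠ j → partialTraceEnv (vecMulVec (x i) (star (x j))) = 0)
    {t : Fin r → ℝ} (ht : ∀ i, 0 ≤ t i) :
    partialTraceEnv (vecMulVec (∑ i, ((√(t i) : ℝ) : ℂ) • x i)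
      (star (∑ i, ((√(t i) : ℝ) : ℂ) • x i))) =
      ∑ i, (t i : ℂ) • partialTraceEnv (vecMulVec (x i) (star (x i))) := by
  have h : vecMulVec (∑ i, ((√(t i) : ℝ) : ℂ) • x i) (star (∑ i, ((√(t i) : ℝ) : ℂ) • x i)) =
      ∑ i, ∑ j, (((√(t i) : ℝ) : ℂ) * ((√(t j) : ℝ) : ℂ)) • vecMulVec (x i) (star (x j)) := by
    ext p q
    simp only [vecMulVec_apply, Finset.sum_apply, Pi.smul_apply, Pi.star_apply, star_sum, star_smul,
      Matrix.sum_apply, Matrix.smul_apply, smul_eq_mul, Finset.sum_mul_sum, RCLike.star_def,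
      Complex.conj_ofReal]
    refine Finset.sum_congr rfl fun i _ => Finset.sum_congr rfl fun j _ => ?_
    ring
  rw [h, partialTraceEnv_sum]
  refine Finset.sum_congr rfl fun i _ => ?_
  rw [partialTraceEnv_sum, Finset.sum_eq_single i, partialTraceEnv_smul, ← Complex.ofReal_mul,
    Real.mul_self_sqrt (ht i)]
  · intro j _ hji
    rw [partialTraceEnv_smul, hx i j hji.symm, smul_zero]
  · simp

variable {P : Matrix (Fin k × Fin n) (Fin k × Fin n) ℂ}

/-- Eigenvectors of `P (A ⊗ 1) P` for nonzero eigenvalues lie in the range of `P`. -/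
theorem projection_mul_eigenvectors {m : ℕ} (hP : IsStarProjection P)
    {X : Matrix (Fin k × Fin n) (Fin k × Fin n) ℂ}
    {W : Matrix (Fin k × Fin n) (Fin m) ℂ} {l : Fin m → ℝ}
    (hW : P * X * P * W = W * diagonal fun j => (l j : ℂ)) (hl : ∀ j, l j ≠ 0) : P * W = W := by
  -- divide by the eigenvalues: `W = P X P W diag(l)⁻¹`
  have h1 : W = P * X * P * W * diagonal fun j => ((l j)⁻¹ : ℂ) := by
    rw [hW, Matrix.mul_assoc, diagonal_mul_diagonal]
    have : (diagonal fun j => (l j : ℂ) * (l j : ℂ)⁻¹) = 1 := by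
      rw [← diagonal_one]
      congr 1
      ext j
      exact mul_inv_cancel₀ (Complex.ofReal_ne_zero.2 (hl j))
    rw [this, Matrix.mul_one]
  have hPP : P * P = P := hP.isIdempotentElem.eq
  conv_lhs => rw [h1]
  simp only [← Matrix.mul_assoc, hPP]
  exact h1.symm

/-- A unit vector in the span of eigenvectors of `P (A ⊗ 1) P` for eigenvalues at least `μ` has a
reduced state with `Tr[· A] ≥ μ`. -/
theorem le_re_trace_partialTraceEnv_mul {m : ℕ} (hP : IsStarProjection P)
    {A : Matrix (Fin k) (Fin k) ℂ} {W : Matrix (Fin k × Fin n) (Fin m) ℂ} {l : Fin m → ℝ}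
    (hW : P * (A ⊗ₖ (1 : Matrix (Fin n) (Fin n) ℂ)) * P * W = W * diagonal fun j => (l j : ℂ))
    (hW1 : Wᴴ * W = 1) (hPW : P * W = W) {c : Fin m → ℂ} (hc : star c ⬝ᵥ c = 1) {μ : ℝ}
    (hμ : ∀ j, μ ≤ l j) :
    μ ≤ (partialTraceEnv (vecMulVec (W *ᵥ c) (star (W *ᵥ c))) * A).trace.re := by
  set Y := A ⊗ₖ (1 : Matrix (Fin n) (Fin n) ℂ)
  have hPs : Pᴴ = P := hP.isSelfAdjoint.star_eq
  have hWP : Wᴴ * P = Wᴴ := by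
    rw [← hPs, ← conjTranspose_mul, hPW]
  have hYW : Wᴴ * Y * W = diagonal fun j => (l j : ℂ) := by
    calc Wᴴ * Y * W = (Wᴴ * P) * Y * (P * W) := by rw [hWP, hPW]
      _ = Wᴴ * (P * Y * P * W) := by simp only [Matrix.mul_assoc]
      _ = _ := by rw [hW, ← Matrix.mul_assoc, hW1, Matrix.one_mul]
  have h1 : (partialTraceEnv (vecMulVec (W *ᵥ c) (star (W *ᵥ c))) * A).trace =
      ∑ j, (l j : ℂ) * (star (c j) * c j) := by
    rw [trace_partialTraceEnv_mul, vecMulVec_mul, trace_vecMulVec, dotProduct_comm, star_mulVec,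
      vecMul_vecMul, dotProduct_mulVec, vecMul_vecMul, hYW, ← dotProduct_mulVec]
    simp only [dotProduct, mulVec_diagonal, Pi.star_apply]
    exact Finset.sum_congr rfl fun j _ => by ring
  have h2 : ∑ j, ‖c j‖ ^ 2 = 1 := by
    have : ((∑ j, ‖c j‖ ^ 2 : ℝ) : ℂ) = 1 := by
      rw [← hc, dotProduct]
      push_cast
      exact Finset.sum_congr rfl fun j _ => (Complex.conj_mul' (c j)).symm
    exact_mod_cast this
  have h3 : (partialTraceEnv (vecMulVec (W *ᵥ c) (star (W *ᵥ c))) * A).trace.re =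
      ∑ j, l j * ‖c j‖ ^ 2 := by
    rw [h1]
    have : ∑ j, (l j : ℂ) * (star (c j) * c j) = ((∑ j, l j * ‖c j‖ ^ 2 : ℝ) : ℂ) := by
      push_cast
      exact Finset.sum_congr rfl fun j _ => by
        rw [RCLike.star_def, Complex.conj_mul']
    rw [this, Complex.ofReal_re]
  rw [h3]
  calc μ = ∑ j, μ * ‖c j‖ ^ 2 := by rw [← Finset.mul_sum, h2, mul_one]
    _ ≤ _ := Finset.sum_le_sum fun j _ => mul_le_mul_of_nonneg_right (hμ j) (sq_nonneg _)

/-- When the `m` largest eigenvalues of every `P (A i ⊗ 1) P` are positive, there are reduced states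
`Y i` of vectors in the range of `P`, nearly maximal in the direction `A i`, all of whose mixtures
are outputs of pure states. -/
theorem exists_states_convexHull_subset_pureOutputs {N m r : ℕ}
    {V : Matrix (Fin k × Fin n) (Fin N) ℂ} (hV : Vᴴ * V = 1) (hP : IsStarProjection P)
    (hVP : V * Vᴴ = P) (hm : (r - 1) * k ^ 2 < m) (hmn : m ≤ k * n)
    {A : Fin r → Matrix (Fin k) (Fin k) ℂ} (hA : ∀ i, (A i).IsHermitian)
    (hpos : ∀ i, ∀ j < m,
      0 < nthEigenvalue (P * (A i ⊗ₖ (1 : Matrix (Fin n) (Fin n) ℂ)) * P) j) :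
    ∃ Y : Fin r → Matrix (Fin k) (Fin k) ℂ, (∀ i, Y i ∈ pureOutputs V) ∧
      (∀ i μ, (∀ j < m, μ ≤ nthEigenvalue (P * (A i ⊗ₖ (1 : Matrix (Fin n) (Fin n) ℂ)) * P) j) →
        μ ≤ (Y i * A i).trace.re) ∧
      ∀ t : Fin r → ℝ, (∀ i, 0 ≤ t i) → ∑ i, t i = 1 → ∑ i, (t i : ℂ) • Y i ∈ pureOutputs V := by
  have hcard : m ≤ Fintype.card (Fin k × Fin n) := by simpa using hmn
  choose W hW1 hW using fun i =>
    exists_isometry_top_eigenvectors (isHermitian_compression hP (hA i)) hcard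
  obtain ⟨c, hc1, hc⟩ := exists_unit_vectors_partialTraceEnv_cross_eq_zero hm W
  have hPW : ∀ i, P * W i = W i := fun i =>
    projection_mul_eigenvectors hP (hW i) fun j => (hpos i j j.2).ne'
  have hPx : ∀ i, (V * Vᴴ) *ᵥ (W i *ᵥ c i) = W i *ᵥ c i := fun i => by
    rw [hVP, mulVec_mulVec, hPW]
  have hx1 : ∀ i, (W i *ᵥ c i) ⬝ᵥ star (W i *ᵥ c i) = 1 := fun i => by
    rw [dotProduct_comm, star_mulVec, dotProduct_mulVec, vecMul_vecMul, hW1, vecMul_one, hc1]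
  refine ⟨fun i => partialTraceEnv (vecMulVec (W i *ᵥ c i) (star (W i *ᵥ c i))),
    fun i => partialTraceEnv_vecMulVec_mem_pureOutputs hV (hPx i) (hx1 i),
    fun i μ hμ => le_re_trace_partialTraceEnv_mul hP (hW i) (hW1 i) (hPW i) (hc1 i)
      fun j => hμ j j.2, fun t ht ht1 => ?_⟩
  have hsup := partialTraceEnv_superposition hc ht
  rw [← hsup]
  refine partialTraceEnv_vecMulVec_mem_pureOutputs hV ?_ ?_
  · rw [mulVec_sum]
    exact Finset.sum_congr rfl fun i _ => by rw [mulVec_smul, hPx]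
  · rw [← trace_vecMulVec, ← trace_partialTraceEnv, hsup, trace_sum]
    simp only [trace_smul, trace_partialTraceEnv, trace_vecMulVec, hx1, smul_eq_mul, mul_one]
    exact_mod_cast ht1

end OrthogonalEnvironments

/-! ### The space of states and its functionals -/

section States

open Matrix

variable {k : ℕ}

open scoped MatrixOrder in
/-- Every state is `Bᴴ B` with `B` in the compact Hilbert–Schmidt unit sphere. -/
theorem isCompact_states (k : ℕ) : IsCompact (states k) := by
  let S : Set (Matrix (Fin k) (Fin k) ℂ) := {B | (Bᴴ * B).trace = 1}
  have hS : IsCompact S := by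
    have hpi : IsCompact (Set.univ.pi fun _ : Fin k => Set.univ.pi fun _ : Fin k =>
        Metric.closedBall (0 : ℂ) 1) :=
      isCompact_univ_pi fun _ => isCompact_univ_pi fun _ => isCompact_closedBall _ _
    refine hpi.of_isClosed_subset (isClosed_eq ?_ continuous_const) fun (B : Matrix (Fin k) (Fin k) ℂ)
      (hB : (Bᴴ * B).trace = 1) i _ j _ => ?_
    · exact (continuous_id.matrix_conjTranspose.matrix_mul continuous_id).matrix_trace
    · have h : ∑ j, ∑ i, ‖B i j‖ ^ 2 = 1 := by
        have : ((∑ j, ∑ i, ‖B i j‖ ^ 2 : ℝ) : ℂ) = 1 := by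
          rw [← hB]
          simp only [trace, diag_apply, mul_apply, conjTranspose_apply, RCLike.star_def,
            Complex.conj_mul']
          push_cast
          rfl
        exact_mod_cast this
      have h1 : ‖B i j‖ ^ 2 ≤ 1 := by
        rw [← h]
        exact (Finset.single_le_sum (f := fun i => ‖B i j‖ ^ 2) (fun _ _ => sq_nonneg _)
          (Finset.mem_univ i)).trans (Finset.single_le_sum (f := fun j => ∑ i, ‖B i j‖ ^ 2)
          (fun _ _ => Finset.sum_nonneg fun _ _ => sq_nonneg _) (Finset.mem_univ j))
      rw [mem_closedBall_zero_iff]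
      exact (sq_le_one_iff₀ (norm_nonneg _)).1 h1
  convert hS.image (f := fun B => Bᴴ * B)
    (continuous_id.matrix_conjTranspose.matrix_mul continuous_id) using 1
  ext A
  constructor
  · rintro ⟨hA, hA1⟩
    obtain ⟨B, rfl⟩ := CStarAlgebra.nonneg_iff_eq_star_mul_self.1 hA.nonneg
    exact ⟨B, hA1, rfl⟩
  · rintro ⟨B, hB, rfl⟩
    exact ⟨posSemidef_conjTranspose_mul_self B, hB⟩

theorem continuous_re_trace_mul (A : Matrix (Fin k) (Fin k) ℂ) :
    Continuous fun B : Matrix (Fin k) (Fin k) ℂ => (B * A).trace.re :=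
  Complex.continuous_re.comp (continuous_id.matrix_mul continuous_const).matrix_trace

theorem isCompact_limitSet (f : Matrix (Fin k) (Fin k) ℂ → ℝ) : IsCompact (limitSet f) := by
  have : limitSet f = states k ∩ ⋂ A ∈ states k, {B | (B * A).trace.re ≤ f A} := by
    ext B
    simp [limitSet]
  rw [this]
  exact (isCompact_states k).inter_right
    (isClosed_biInter fun A _ => isClosed_le (continuous_re_trace_mul A) continuous_const)

/-- States that asymptotically satisfy the inequalities defining `limitSet f`, and asymptotically
attain equality for some `A` which exposes the point `E`, converge to `E`. -/
theorem tendsto_of_exposed {f : Matrix (Fin k) (Fin k) ℂ → ℝ}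
    {Y : ℕ → Matrix (Fin k) (Fin k) ℂ} (hY : ∀ᶠ n in atTop, Y n ∈ states k)
    (hle : ∀ A ∈ states k, ∀ ε > 0, ∀ᶠ n in atTop, (Y n * A).trace.re ≤ f A + ε)
    {A E : Matrix (Fin k) (Fin k) ℂ} (hA : A ∈ states k)
    (hge : ∀ ε > 0, ∀ᶠ n in atTop, f A - ε ≤ (Y n * A).trace.re) (hE : E ∈ limitSet f)
    (huniq : ∀ B ∈ limitSet f, (E * A).trace.re ≤ (B * A).trace.re → B = E) :
    Tendsto Y atTop (𝓝 E) := by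
  refine (isCompact_states k).tendsto_nhds_of_unique_mapClusterPt hY fun B hB hcl => ?_
  have h1 : ∀ A' ∈ states k, (B * A').trace.re ≤ f A' := fun A' hA' =>
    le_of_forall_pos_le_add fun ε hε =>
      (isClosed_le (continuous_re_trace_mul A') continuous_const).mem_of_mapClusterPt hcl
        (hle A' hA' ε hε)
  have h2 : f A ≤ (B * A).trace.re := le_of_forall_sub_le fun ε hε =>
      (isClosed_le continuous_const (continuous_re_trace_mul A)).mem_of_mapClusterPt hcl
        (hge ε hε)
  exact huniq B ⟨hB, h1⟩ ((hE.2 A hA).trans h2)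

/-- The real vector space of traceless Hermitian matrices, which is the direction of the affine
space `traceOneHermitian k`. -/
def tracelessHermitian (k : ℕ) : Submodule ℝ (Matrix (Fin k) (Fin k) ℂ) where
  carrier := {H | H.IsHermitian ∧ H.trace = 0}
  add_mem' := fun ha hb => ⟨ha.1.add hb.1, by rw [trace_add, ha.2, hb.2, add_zero]⟩
  zero_mem' := ⟨isHermitian_zero, trace_zero _ _⟩
  smul_mem' := fun c H hH => ⟨by
    rw [IsHermitian, conjTranspose_smul, hH.1.eq, star_trivial], by
    rw [trace_smul, hH.2, smul_zero]⟩

theorem finrank_tracelessHermitian_le (hk : 1 ≤ k) :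
    Module.finrank ℝ (tracelessHermitian k) + 1 ≤ k ^ 2 := by
  -- `(H, H', z) ↦ H + i H' + z 1` embeds a space of dimension `2 d + 2` into one of dimension `2 k²`
  let W := tracelessHermitian k
  let Φ : (W × W) × ℂ →ₗ[ℝ] Matrix (Fin k) (Fin k) ℂ :=
    { toFun := fun p => (p.1.1 : Matrix (Fin k) (Fin k) ℂ) + Complex.I • (p.1.2 : Matrix _ _ ℂ)
        + p.2 • (1 : Matrix (Fin k) (Fin k) ℂ)
      map_add' := fun p q => by
        simp only [Prod.fst_add, Prod.snd_add, Submodule.coe_add, smul_add, add_smul]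
        abel
      map_smul' := fun c p => by
        simp only [Prod.smul_fst, Prod.smul_snd, SetLike.val_smul, smul_add, RingHom.id_apply,
          smul_comm c Complex.I, smul_assoc] }
  have hΦ : Function.Injective Φ := by
    rw [← LinearMap.ker_eq_bot, LinearMap.ker_eq_bot']
    rintro ⟨⟨⟨H, hH⟩, ⟨H', hH'⟩⟩, z⟩ h
    have h : H + Complex.I • H' + z • (1 : Matrix (Fin k) (Fin k) ℂ) = 0 := h
    have hz : z = 0 := by
      have := congrArg trace h
      rw [trace_add, trace_add, trace_smul, trace_smul, hH.2, hH'.2, trace_one, trace_zero] at this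
      have hk0 : (k : ℂ) ≠ 0 := Nat.cast_ne_zero.2 (by omega)
      simpa [hk0] using this
    rw [hz, zero_smul, add_zero] at h
    have h' : H - Complex.I • H' = 0 := by
      have := congrArg conjTranspose h
      rw [conjTranspose_add, conjTranspose_smul, hH.1.eq, hH'.1.eq, conjTranspose_zero] at this
      simpa [sub_eq_add_neg] using this
    have hH0 : H = 0 := by
      have : (2 : ℂ) • H = 0 := by
        rw [two_smul, show H + H = (H + Complex.I • H') + (H - Complex.I • H') by abel, h, h',
          add_zero]
      simpa using this
    subst hH0
    have hH'0 : H' = 0 := by simpa using h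
    subst hH'0
    subst hz
    rfl
  have h := LinearMap.finrank_le_finrank_of_injective hΦ
  rw [Module.finrank_prod, Module.finrank_prod, Complex.finrank_real_complex,
    ← Module.finrank_mul_finrank ℝ ℂ (Matrix (Fin k) (Fin k) ℂ), Complex.finrank_real_complex,
    Module.finrank_matrix, Module.finrank_self, Fintype.card_fin, mul_one, ← sq] at h
  change Module.finrank ℝ W + 1 ≤ k ^ 2
  omega

/-- Linear functionals on the traceless Hermitian matrices are represented through the
Hilbert–Schmidt inner product. -/
theorem exists_tracelessHermitian_represents (φ : tracelessHermitian k →ₗ[ℝ] ℝ) :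
    ∃ H ∈ tracelessHermitian k, ∀ B : tracelessHermitian k,
      φ B = ((B : Matrix (Fin k) (Fin k) ℂ) * H).trace.re := by
  let Ψ : tracelessHermitian k →ₗ[ℝ] Module.Dual ℝ (tracelessHermitian k) :=
    LinearMap.mk₂ ℝ (fun H B => ((B : Matrix (Fin k) (Fin k) ℂ) * H).trace.re)
      (fun _ _ _ => by simp [mul_add]) (fun _ _ _ => by simp)
      (fun _ _ _ => by simp [add_mul]) (fun _ _ _ => by simp)
  have hinj : Function.Injective Ψ := by
    rw [← LinearMap.ker_eq_bot, LinearMap.ker_eq_bot']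
    rintro ⟨H, hH⟩ h
    have h1 : (H * H).trace.re = 0 := LinearMap.congr_fun h ⟨H, hH⟩
    have h2 : 0 ≤ (Hᴴ * H).trace := (posSemidef_conjTranspose_mul_self H).trace_nonneg
    have h3 : (Hᴴ * H).trace = 0 :=
      Complex.ext (by rw [hH.1.eq, h1, Complex.zero_re]) (Complex.nonneg_iff.1 h2).2.symm
    simpa using trace_conjTranspose_mul_self_eq_zero_iff.1 h3
  have hsurj := (LinearMap.injective_iff_surjective_of_finrank_eq_finrank
    Subspace.dual_finrank_eq.symm).1 hinj
  obtain ⟨⟨H, hH⟩, rfl⟩ := hsurj φ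
  exact ⟨H, hH, fun B => rfl⟩

/-- On matrices of trace one, a traceless Hermitian `H` defines, up to an increasing affine change
of values, the same functional as some positive definite state `A`. -/
theorem exists_state_affine_functional (hk : 1 ≤ k) {H : Matrix (Fin k) (Fin k) ℂ}
    (hH : H ∈ tracelessHermitian k) :
    ∃ A ∈ states k, (∀ B ∈ states k, 0 < (B * A).trace.re) ∧ ∃ a > 0, ∃ q : ℝ,
      ∀ B : Matrix (Fin k) (Fin k) ℂ, B.trace = 1 → (B * A).trace.re = q + a * (B * H).trace.re := by
  set l := nthEigenvalue (-H) 0 with hl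
  have hpsd : ((l : ℂ) • (1 : Matrix (Fin k) (Fin k) ℂ) + H).PosSemidef := by
    have := posSemidef_nthEigenvalue_zero_sub hH.1.neg
    rwa [sub_neg_eq_add] at this
  -- `c > l` makes `c + H` positive definite
  set c := |l| + 1 with hc
  have hc0 : 0 < c := by positivity
  have hlc : l < c := by linarith [le_abs_self l]
  have hk0 : (0 : ℝ) < k := by exact_mod_cast hk
  set a := (c * k)⁻¹ with ha
  have ha0 : 0 < a := by positivity
  have hval : ∀ B : Matrix (Fin k) (Fin k) ℂ, B.trace = 1 →
      (B * ((a : ℂ) • ((c : ℂ) • (1 : Matrix (Fin k) (Fin k) ℂ) + H))).trace.re =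
        a * c + a * (B * H).trace.re := fun B hB => by
    rw [Matrix.mul_smul, mul_add, Matrix.mul_smul, mul_one, trace_smul, trace_add, trace_smul, hB]
    simp [mul_add]
  refine ⟨(a : ℂ) • ((c : ℂ) • (1 : Matrix (Fin k) (Fin k) ℂ) + H), ⟨?_, ?_⟩, fun B hB => ?_,
    a, ha0, a * c, hval⟩
  · have h : (c : ℂ) • (1 : Matrix (Fin k) (Fin k) ℂ) + H =
        ((l : ℂ) • (1 : Matrix (Fin k) (Fin k) ℂ) + H) +
          ((c - l : ℝ) : ℂ) • (1 : Matrix (Fin k) (Fin k) ℂ) := by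
      push_cast
      rw [sub_smul]
      abel
    rw [h]
    refine PosSemidef.smul (hpsd.add (PosSemidef.one.smul ?_)) ?_
    · exact Complex.zero_le_real.2 (by linarith)
    · exact Complex.zero_le_real.2 ha0.le
  · rw [trace_smul, trace_add, trace_smul, hH.2, trace_one, Fintype.card_fin, add_zero, smul_eq_mul,
      smul_eq_mul, ha]
    push_cast
    exact inv_mul_cancel₀ (by exact_mod_cast (mul_pos hc0 hk0).ne')
  · rw [hval B hB.2]
    have h := re_trace_mul_nonneg hB.1 hpsd
    rw [mul_add, Matrix.mul_smul, mul_one, trace_add, trace_smul, hB.2] at h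
    have h' : 0 ≤ l + (B * H).trace.re := by simpa using h
    rw [← mul_add]
    exact mul_pos ha0 (by linarith)

end States

/-! ### Lower and upper limits of the output sets -/

section Main

open Matrix

variable {k : ℕ}

/-- A point `b` in the relative interior of a compact set `K` of states is a convex combination of
any matrices close enough to suitable exposed points `E i` of `K`, where `E i` is exposed by a
positive definite state `A i`. -/
theorem exists_exposed_states {K : Set (Matrix (Fin k) (Fin k) ℂ)} (hK : IsCompact K)
    (hKs : K ⊆ states k) {b : Matrix (Fin k) (Fin k) ℂ} (hb : b ∈ stateInterior K) {r : ℕ}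
    (hr : 2 * (k ^ 2 - 1) ≤ r) (hr1 : 1 ≤ r) :
    ∃ E A : Fin r → Matrix (Fin k) (Fin k) ℂ,
      (∀ i, A i ∈ states k ∧ (∀ B ∈ states k, 0 < (B * A i).trace.re) ∧ E i ∈ K ∧
        ∀ B ∈ K, (E i * A i).trace.re ≤ (B * A i).trace.re → B = E i) ∧
      ∀ᶠ Y in 𝓝 E, (∀ i, Y i ∈ states k) →
        ∃ t : Fin r → ℝ, (∀ i, 0 ≤ t i) ∧ ∑ i, t i = 1 ∧ ∑ i, (t i : ℂ) • Y i = b := by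
  obtain ⟨⟨b, hbH⟩, hbint, rfl⟩ := hb
  have hk : 1 ≤ k := by
    rcases Nat.eq_zero_or_pos k with rfl | h
    · have := hbH.2
      rw [trace_fin_zero] at this
      exact (zero_ne_one this).elim
    · exact h
  let W := tracelessHermitian k
  let e : W ≃L[ℝ] EuclideanSpace ℝ (Fin (Module.finrank ℝ W)) := toEuclidean
  have hsub : ∀ B ∈ states k, B - b ∈ W := fun B hB =>
    ⟨hB.1.1.sub hbH.1, by rw [trace_sub, hB.2, hbH.2, sub_self]⟩
  -- the affine chart of `traceOneHermitian k` centred at `b`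
  let g : EuclideanSpace ℝ (Fin (Module.finrank ℝ W)) → Matrix (Fin k) (Fin k) ℂ :=
    fun y => b + (e.symm y : Matrix (Fin k) (Fin k) ℂ)
  have hg1 : ∀ y, g y ∈ traceOneHermitian k := fun y =>
    ⟨hbH.1.add (e.symm y).2.1, by
      change (b + (e.symm y : Matrix (Fin k) (Fin k) ℂ)).trace = 1
      rw [trace_add, hbH.2, (e.symm y).2.2, add_zero]⟩
  have hgclosed : IsClosedEmbedding g :=
    (Homeomorph.addLeft b).isClosedEmbedding.comp
      ((Submodule.closed_of_finiteDimensional W).isClosedEmbedding_subtypeVal.comp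
        e.symm.toHomeomorph.isClosedEmbedding)
  have hg0 : g 0 = b := by simp [g]
  have hgsurj : ∀ B ∈ states k, ∃ y, g y = B := fun B hB =>
    ⟨e ⟨B - b, hsub B hB⟩, by simp [g]⟩
  have hint : (0 : EuclideanSpace ℝ (Fin (Module.finrank ℝ W))) ∈ interior (g ⁻¹' K) := by
    have hcont : Continuous fun y => (⟨g y, hg1 y⟩ : traceOneHermitian k) :=
      hgclosed.continuous.subtype_mk _
    have h0 : (⟨g 0, hg1 0⟩ : traceOneHermitian k) = ⟨b, hbH⟩ := Subtype.ext hg0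
    have h := preimage_interior_subset_interior_preimage hcont (Set.mem_preimage.2 (h0 ▸ hbint))
    exact h
  have hdim : 2 * Module.finrank ℝ (EuclideanSpace ℝ (Fin (Module.finrank ℝ W))) ≤ r := by
    rw [finrank_euclideanSpace, Fintype.card_fin]
    have := finrank_tracelessHermitian_le hk
    change Module.finrank ℝ W + 1 ≤ k ^ 2 at this
    omega
  obtain ⟨E, hE, ε, hε, hstable⟩ := exists_exposedPoints_convexHull_stable
    (hgclosed.isCompact_preimage hK) hint hdim hr1
  have hA : ∀ i, ∃ A ∈ states k, (∀ B ∈ states k, 0 < (B * A).trace.re) ∧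
      ∀ B ∈ K, (g (E i) * A).trace.re ≤ (B * A).trace.re → B = g (E i) := by
    intro i
    obtain ⟨hEK, φ, hφ⟩ := hE i
    obtain ⟨H, hH, hφH⟩ := exists_tracelessHermitian_represents
      ((φ : _ →ₗ[ℝ] ℝ) ∘ₗ (e : W →ₗ[ℝ] EuclideanSpace ℝ (Fin (Module.finrank ℝ W))))
    obtain ⟨A, hAs, hApos, a, ha, q, hAq⟩ := exists_state_affine_functional hk hH
    refine ⟨A, hAs, hApos, fun B hB hle => ?_⟩
    obtain ⟨y, rfl⟩ := hgsurj B (hKs hB)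
    have hval : ∀ y, (g y * H).trace.re = (b * H).trace.re + φ y := fun y => by
      have := hφH (e.symm y)
      simp only [LinearMap.comp_apply, ContinuousLinearMap.coe_coe] at this
      rw [show φ y = φ (e (e.symm y)) by simp]
      refine Eq.trans ?_ (congrArg ((b * H).trace.re + ·) this).symm
      simp [g, add_mul]
    rw [hAq _ (hg1 _).2, hAq _ (hg1 _).2, hval, hval] at hle
    rw [(hφ y hB).2 (by nlinarith)]
  choose A hAs hApos hAu using hA
  refine ⟨fun i => g (E i), A, fun i => ⟨hAs i, hApos i, (hE i).1, hAu i⟩, ?_⟩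
  -- a linear retraction onto the chart
  obtain ⟨p, hp⟩ := LinearMap.exists_leftInverse_of_injective
    (W.subtype ∘ₗ (e.symm : EuclideanSpace ℝ (Fin (Module.finrank ℝ W)) →ₗ[ℝ] W))
    (LinearMap.ker_eq_bot.2 (W.injective_subtype.comp e.symm.injective))
  have hpe : ∀ y, p (e.symm y : Matrix (Fin k) (Fin k) ℂ) = y := fun y => LinearMap.congr_fun hp y
  have hpcont : Continuous p := p.continuous_of_finiteDimensional
  have hev : ∀ᶠ Y in 𝓝 (fun i => g (E i)), ∀ i, dist (p (Y i - b)) (E i) < ε := by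
    rw [eventually_all]
    intro i
    have hc : Continuous fun Y : Fin r → Matrix (Fin k) (Fin k) ℂ => p (Y i - b) :=
      hpcont.comp ((continuous_apply i).sub continuous_const)
    have hlim := hc.tendsto (fun i => g (E i))
    have : p (g (E i) - b) = E i := by simp [g, hpe]
    rw [this] at hlim
    exact hlim.eventually (Metric.ball_mem_nhds _ hε)
  filter_upwards [hev] with Y hY hYs
  obtain ⟨t, ht0, ht1, ht⟩ := exists_weights_of_mem_convexHull_range
    (hstable (fun i => p (Y i - b)) hY)
  refine ⟨t, ht0, ht1, ?_⟩
  have hback : ∀ i, ((e.symm (p (Y i - b)) : W) : Matrix (Fin k) (Fin k) ℂ) = Y i - b := fun i => by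
    obtain ⟨y, hy⟩ := hgsurj _ (hYs i)
    have : Y i - b = (e.symm y : Matrix (Fin k) (Fin k) ℂ) := by rw [← hy]; simp [g]
    rw [this, hpe]
  have hsum := congrArg (fun y => ((e.symm y : W) : Matrix (Fin k) (Fin k) ℂ)) ht
  simp only [map_sum, map_smul, Submodule.coe_sum, Submodule.coe_smul, hback, smul_sub,
    Finset.sum_sub_distrib, ← Finset.sum_smul, ht1, one_smul, map_zero, Submodule.coe_zero,
    sub_eq_zero] at hsum
  rw [← hsum]
  exact Finset.sum_congr rfl fun i _ => by ext; simp

theorem eventually_nthEigenvalue_zero_le {m : ℕ} (hm : 0 < m)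
    {P : ∀ n : ℕ, Matrix (Fin k × Fin n) (Fin k × Fin n) ℂ}
    {f : Matrix (Fin k) (Fin k) ℂ → ℝ} (hC : ConditionC m P f)
    {A : Matrix (Fin k) (Fin k) ℂ} (hA : A ∈ states k) {ε : ℝ} (hε : 0 < ε) :
    ∀ᶠ n in atTop,
      nthEigenvalue (P n * (A ⊗ₖ (1 : Matrix (Fin n) (Fin n) ℂ)) * P n) 0 ≤ f A + ε :=
  (hC A hA 0 hm).eventually_le_const (by linarith)

theorem setLimsup_pureOutputs_subset {m : ℕ} (hm : 0 < m)
    {P : ∀ n : ℕ, Matrix (Fin k × Fin n) (Fin k × Fin n) ℂ} (hP : ∀ n, IsStarProjection (P n))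
    {f : Matrix (Fin k) (Fin k) ℂ → ℝ} (hC : ConditionC m P f)
    {N : ℕ → ℕ} {V : ∀ n : ℕ, Matrix (Fin k × Fin n) (Fin (N n)) ℂ}
    (hV : ∀ n, (V n)ᴴ * V n = 1) (hVP : ∀ n, V n * (V n)ᴴ = P n) :
    setLimsup (fun n => pureOutputs (V n)) ⊆ limitSet f := by
  intro B hB
  have hfreq : ∃ᶠ n in atTop, B ∈ pureOutputs (V n) := by
    rw [frequently_atTop]
    intro r
    simpa using Set.mem_iInter.1 hB r
  obtain ⟨n, hn⟩ := hfreq.exists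
  refine ⟨mem_states_of_mem_pureOutputs (hV n) hn, fun A hA => ?_⟩
  refine le_of_forall_pos_le_add fun ε hε => ?_
  obtain ⟨n, hn, hle⟩ :=
    (hfreq.and_eventually (eventually_nthEigenvalue_zero_le hm hC hA hε)).exists
  exact (re_trace_mul_le_of_mem_pureOutputs (hV n) (hP n) (hVP n) hn hA).trans hle

theorem setLiminf_subset_setLimsup {α : Type*} (S : ℕ → Set α) : setLiminf S ⊆ setLimsup S := by
  intro x hx
  obtain ⟨r, hr⟩ := Set.mem_iUnion.1 hx
  refine Set.mem_iInter.2 fun s => ?_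
  exact Set.mem_iUnion₂.2 ⟨max r s, le_max_right _ _, Set.mem_iInter₂.1 hr _ (le_max_left _ _)⟩

/-- The lower inclusion, for any number `r` of exposed points that suffices for Steinitz's theorem.
The dimension count for the vectors requires `(r - 1) k² < m`. -/
theorem stateInterior_limitSet_subset_setLiminf {m r : ℕ} (hr : 2 * (k ^ 2 - 1) ≤ r) (hr1 : 1 ≤ r)
    (hm : (r - 1) * k ^ 2 < m)
    {P : ∀ n : ℕ, Matrix (Fin k × Fin n) (Fin k × Fin n) ℂ} (hP : ∀ n, IsStarProjection (P n))
    {f : Matrix (Fin k) (Fin k) ℂ → ℝ} (hC : ConditionC m P f)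
    {N : ℕ → ℕ} {V : ∀ n : ℕ, Matrix (Fin k × Fin n) (Fin (N n)) ℂ}
    (hV : ∀ n, (V n)ᴴ * V n = 1) (hVP : ∀ n, V n * (V n)ᴴ = P n) :
    stateInterior (limitSet f) ⊆ setLiminf (fun n => pureOutputs (V n)) := by
  intro b hb
  have hm0 : 0 < m := (Nat.zero_le _).trans_lt hm
  have hk : 1 ≤ k := by
    rcases Nat.eq_zero_or_pos k with rfl | h
    · obtain ⟨b', -, -⟩ := hb
      have := b'.2.2
      rw [trace_fin_zero] at this
      exact (zero_ne_one this).elim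
    · exact h
  obtain ⟨E, A, hEA, hnear⟩ := exists_exposed_states (isCompact_limitSet f) (fun B hB => hB.1) hb
    hr hr1
  -- positivity of `f (A i)` is what puts the top eigenvectors into the range of `P n`
  have hfpos : ∀ i, 0 < f (A i) := fun i =>
    ((hEA i).2.1 _ (hEA i).2.2.1.1).trans_le ((hEA i).2.2.1.2 _ (hEA i).1)
  have hlow : ∀ i, ∀ u < f (A i), ∀ᶠ n in atTop, ∀ j < m,
      u < nthEigenvalue (P n * (A i ⊗ₖ (1 : Matrix (Fin n) (Fin n) ℂ)) * P n) j := by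
    intro i u hu
    have := (Finset.range m).eventually_all (l := atTop) (p := fun j n =>
      u < nthEigenvalue (P n * (A i ⊗ₖ (1 : Matrix (Fin n) (Fin n) ℂ)) * P n) j)
    simp only [Finset.mem_range] at this
    exact this.2 fun j hj => (hC (A i) (hEA i).1 j hj).eventually_const_lt hu
  have hgood : ∀ᶠ n in atTop, m ≤ k * n ∧ ∀ i, ∀ j < m,
      0 < nthEigenvalue (P n * (A i ⊗ₖ (1 : Matrix (Fin n) (Fin n) ℂ)) * P n) j := by
    refine ((eventually_ge_atTop m).mono fun n hn => hn.trans (Nat.le_mul_of_pos_left n hk)).and ?_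
    exact eventually_all.2 fun i => hlow i 0 (hfpos i)
  have hex : ∀ n, ∃ Y : Fin r → Matrix (Fin k) (Fin k) ℂ, (m ≤ k * n ∧ ∀ i, ∀ j < m,
      0 < nthEigenvalue (P n * (A i ⊗ₖ (1 : Matrix (Fin n) (Fin n) ℂ)) * P n) j) →
      (∀ i, Y i ∈ pureOutputs (V n)) ∧
      (∀ i μ, (∀ j < m, μ ≤ nthEigenvalue
        (P n * (A i ⊗ₖ (1 : Matrix (Fin n) (Fin n) ℂ)) * P n) j) → μ ≤ (Y i * A i).trace.re) ∧
      ∀ t : Fin r → ℝ, (∀ i, 0 ≤ t i) → ∑ i, t i = 1 →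
        ∑ i, (t i : ℂ) • Y i ∈ pureOutputs (V n) := by
    intro n
    by_cases h : m ≤ k * n ∧ ∀ i, ∀ j < m,
        0 < nthEigenvalue (P n * (A i ⊗ₖ (1 : Matrix (Fin n) (Fin n) ℂ)) * P n) j
    · obtain ⟨Y, hY⟩ := exists_states_convexHull_subset_pureOutputs (hV n) (hP n) (hVP n) hm h.1
        (fun i => (hEA i).1.1.1) h.2
      exact ⟨Y, fun _ => hY⟩
    · exact ⟨0, fun h' => (h h').elim⟩
  choose Y hY using hex
  have hlim : Tendsto Y atTop (𝓝 E) := by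
    rw [tendsto_pi_nhds]
    intro i
    refine tendsto_of_exposed (hgood.mono fun n hn =>
      mem_states_of_mem_pureOutputs (hV n) ((hY n hn).1 i)) (fun A' hA' ε hε => ?_) (hEA i).1
      (fun ε hε => ?_) (hEA i).2.2.1 (hEA i).2.2.2
    · filter_upwards [hgood, eventually_nthEigenvalue_zero_le hm0 hC hA' hε] with n hn hle
      exact (re_trace_mul_le_of_mem_pureOutputs (hV n) (hP n) (hVP n) ((hY n hn).1 i) hA').trans hle
    · filter_upwards [hgood, hlow i (f (A i) - ε) (by linarith)] with n hn hlt
      exact (hY n hn).2.1 i _ fun j hj => (hlt j hj).le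
  obtain ⟨n₀, hn₀⟩ := eventually_atTop.1 (hgood.and (hlim.eventually hnear))
  refine Set.mem_iUnion.2 ⟨n₀, Set.mem_iInter₂.2 fun n hn => ?_⟩
  obtain ⟨hgn, hnearn⟩ := hn₀ n hn
  obtain ⟨t, ht0, ht1, ht⟩ := hnearn fun i =>
    mem_states_of_mem_pureOutputs (hV n) ((hY n hgn).1 i)
  exact ht ▸ (hY n hgn).2.2 t ht0 ht1

end Main

/-- `m = (2k² - 3)k² + 1`; the maximum with `1` matters for `k = 1` only, where this integer is
`0`, while `f` and `K` are defined through `C_1`. -/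
theorem theorem3p5 (k m : ℕ)
    (hm : (m : ℤ) = max 1 ((2 * (k : ℤ) ^ 2 - 3) * (k : ℤ) ^ 2 + 1))
    (P : ∀ n : ℕ, Matrix (Fin k × Fin n) (Fin k × Fin n) ℂ)
    (hP : ∀ n, IsStarProjection (P n))
    (f : Matrix (Fin k) (Fin k) ℂ → ℝ)
    (hC : ConditionC m P f)
    (N : ℕ → ℕ) (V : ∀ n : ℕ, Matrix (Fin k × Fin n) (Fin (N n)) ℂ)
    (hV : ∀ n, (V n)ᴴ * V n = 1)
    (hVP : ∀ n, V n * (V n)ᴴ = P n) :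
    stateInterior (limitSet f) ⊆ setLiminf (fun n => pureOutputs (V n)) ∧
      setLiminf (fun n => pureOutputs (V n)) ⊆ setLimsup (fun n => pureOutputs (V n)) ∧
      setLimsup (fun n => pureOutputs (V n)) ⊆ limitSet f := by
  have hm0 : 0 < m := by
    have : (1 : ℤ) ≤ m := hm ▸ le_max_left _ _
    exact_mod_cast this
  -- `r = 2 (k² - 1)` exposed points, except that one point is needed when `k = 1`
  have hr : (max 1 (2 * (k ^ 2 - 1)) - 1) * k ^ 2 < m := by
    rcases Nat.lt_or_ge k 2 with hk | hk
    · interval_cases k <;> simpa using hm0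
    · have h4 : 4 ≤ k ^ 2 := by nlinarith
      obtain ⟨d, hd⟩ := Nat.exists_eq_add_of_le h4
      have h1 : max 1 (2 * (k ^ 2 - 1)) - 1 = 2 * d + 5 := by omega
      have h2 : ((2 * (k : ℤ) ^ 2 - 3) * (k : ℤ) ^ 2 + 1) ≤ m := hm ▸ le_max_right _ _
      have h3 : (k : ℤ) ^ 2 = 4 + d := by exact_mod_cast hd
      rw [h1, hd]
      rw [h3] at h2
      zify
      linarith
  exact ⟨stateInterior_limitSet_subset_setLiminf (le_max_right _ _) (le_max_left _ _) hr hP hC hV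
    hVP, setLiminf_subset_setLimsup _, setLimsup_pureOutputs_subset hm0 hP hC hV hVP⟩
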